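/- **Setting.** Write $X\in\mathbb R^{n\times d}$ ($n\ge 1$) for the matrix with rows $x_1,\dots,x_n$, the features of the nodes of a graph $G$ on $n$ nodes. An *MLP* is a composition of affine maps with an entrywise activation $\nu$ between consecutive ones; its depth is the number of affine maps. An *equivariant DeepSets network* with entrywise nonlinearity $\nu$ is $F=L_m\circ\nu\circ\cdots\circ\nu\circ L_1$ with $L_i(X)=XA_i+\frac1n\mathbf 1\mathbf 1^TXB_i+\mathbf 1c_i^T$, $A_i,B_i\in\mathbb R^{d_i\times d_{i+1}}$, $c_i\in\mathbb R^{d_{i+1}}$; its depth is $m$, its width $\max_i d_i$. A *heterogeneous MPNN + VN layer* maps the graph node features $x_i$ and the feature $v$ of a virtual node to $$v'=\gamma_{vn}\Big(v,\ \tau_{j\in[n]}\,\phi_{vn\text{-}gn}(v,x_j,e_{j,vn})\Big),\qquad x_i'=\gamma_{gn}\Big(x_i,\ \phi_{gn\text{-}vn}(x_i,v,e_{vn,i})+\tau_{j\in\mathcal N_G(i)}\,\phi_{gn\text{-}gn}(x_i,x_j,e_{j,i})\Big),$$ where $e$ are edge features, $\tau$ is the sum or the mean, and the message functions $\phi$ and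 update functions $\gamma$ are MLPs. It is *simplified* if the parameters of $\phi_{gn\text{-}gn}$ are $0$. An *MPNN + VN* is a composition of such layers with $v=0$ initially; its output is the matrix of final graph node features. Its depth is its number of layers; its width is the largest dimension of a node feature, of a message, or of a hidden layer of one of its MLPs. **Theorem.** There are an absolute constant $C$ and constants $K_{d,d'}$ depending only on $d,d'$ such that, for all $n\ge1$, all $d,d'$, every edge feature dimension, and for sum as well as mean aggregation, the following hold. 1. (Exact simulation.) For every $\nu:\mathbb R\to\mathbb R$ and every equivariant DeepSets network $F:\mathbb R^{n\times d}\to\mathbb R^{n\times d'}$ with nonlinearity $\nu$ there is a simplified MPNN + VN with activation $\nu$ which computes exactly $F$, on every graph with $n$ nodes and for all edge features. Its depth is at most $C\cdot\mathrm{depth}(F)$, its width at most $C\cdot\mathrm{width}(F)$, and its message and update functions are MLPs of depth at most $C$. 2. (Universality.) Let $\mathcal X\subset\mathbb R^{n\times d}$ be compact and let $H:\mathcal X\to\mathbb R^{n\times d'}$ be continuous and permutation equivariant over $\mathcal X$, i.e. $H(\sigma X)=\sigma H(X)$ whenever $\sigma\in S_n$ and $X,\sigma X\in\mathcal X$. Then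 for every $\varepsilon>0$ there is a simplified MPNN + VN $N$ with ReLU activations, of depth at most $C$ and width at most $K_{d,d'}\,n^d$, with $\|H(X)-N(X)\|_\infty<\varepsilon$ for all $X\in\mathcal X$, on every graph with $n$ nodes and for all edge features; here the depth of the MLPs may depend on $H$ and $\varepsilon$. There is also such an $N$ of depth at most $C$ whose message and update functions have depth at most $C$, if its width may depend on $H$ and $\varepsilon$. 3. (Self-attention.) The conclusion of 2 holds for every self-attention layer $H(X)=\mathrm{softmax}\big(XW_Q(XW_K)^T\big)XW_V$ (softmax over rows), $W_Q,W_K\in\mathbb R^{d\times k}$, $W_V\in\mathbb R^{d\times d'}$, on every compact $\mathcal X\subset\mathbb R^{n\times d}$. 4. (Transformers.) The conclusion of 2, with $d'=d$, holds on every compact $\mathcal X\subset\mathbb R^{n\times d}$ for every transformer $H:\mathbb R^{n\times d}\to\mathbb R^{n\times d}$, that is, every finite composition of multi-head self-attention layers, token-wise MLPs with a continuous activation, token-wise layer normalisations $x\mapsto g\odot(x-\mu(x)\mathbf 1)/\sqrt{\mathrm{var}(x)+\delta}+b$ with $\delta>0$, and residual connections $X\mapsto X+T(X)$ around any such part. 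-/

import Mathlib

/-! ### Multilayer perceptrons -/

/-- Parameters of a multilayer perceptron `ℝ^a → ℝ^b`: affine maps `x ↦ W x + c`, with an entrywise
activation function between consecutive affine maps and none after the last one. -/
inductive MLP : ℕ → ℕ → Type
  | affine {a b : ℕ} (W : Matrix (Fin b) (Fin a) ℝ) (c : Fin b → ℝ) : MLP a b
  | layer {a h b : ℕ} (W : Matrix (Fin h) (Fin a) ℝ) (c : Fin h → ℝ) (rest : MLP h b) : MLP a b

/-- The function computed by a multilayer perceptron with activation function `ν`. -/
noncomputable def MLP.eval (ν : ℝ → ℝ) : {a b : ℕ} → MLP a b → (Fin a → ℝ) → (Fin b → ℝ)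
  | _, _, .affine W c, x => W.mulVec x + c
  | _, _, .layer W c rest, x => rest.eval ν (fun k => ν ((W.mulVec x + c) k))

/-- The largest dimension of a hidden layer (`0` if there is none). -/
def MLP.hiddenWidth : {a b : ℕ} → MLP a b → ℕ
  | _, _, .affine _ _ => 0
  | _, _, .layer (h := h) _ _ rest => max h rest.hiddenWidth

/-- The number of affine maps. -/
def MLP.depth : {a b : ℕ} → MLP a b → ℕ
  | _, _, .affine _ _ => 1
  | _, _, .layer _ _ rest => rest.depth + 1

/-- The rectified linear unit. -/
def relu (t : ℝ) : ℝ := max t 0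

/-! ### Equivariant DeepSets -/

/-- The linear permutation equivariant layer `X ↦ X A + (1/n) 1 1ᵀ X B + 1 cᵀ`. -/
noncomputable def deepSetsLinear {n a b : ℕ} (A B : Matrix (Fin a) (Fin b) ℝ) (c : Fin b → ℝ)
    (X : Matrix (Fin n) (Fin a) ℝ) : Matrix (Fin n) (Fin b) ℝ :=
  X * A + (1 / (n : ℝ)) • ((Matrix.vecMulVec 1 1 : Matrix (Fin n) (Fin n) ℝ) * X * B) +
    Matrix.vecMulVec 1 c

/-- Parameters of an equivariant DeepSets network `L_m ∘ ν ∘ ⋯ ∘ ν ∘ L_1`. -/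
inductive DeepSets : ℕ → ℕ → Type
  | last {a b : ℕ} (A B : Matrix (Fin a) (Fin b) ℝ) (c : Fin b → ℝ) : DeepSets a b
  | layer {a h b : ℕ} (A B : Matrix (Fin a) (Fin h) ℝ) (c : Fin h → ℝ) (rest : DeepSets h b) :
      DeepSets a b

/-- The map `ℝ^{n×a} → ℝ^{n×b}` computed by a DeepSets network with entrywise nonlinearity `ν`. -/
noncomputable def DeepSets.eval {n : ℕ} (ν : ℝ → ℝ) : {a b : ℕ} → DeepSets a b →
    Matrix (Fin n) (Fin a) ℝ → Matrix (Fin n) (Fin b) ℝ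
  | _, _, .last A B c, X => deepSetsLinear A B c X
  | _, _, .layer A B c rest, X => rest.eval ν ((deepSetsLinear A B c X).map ν)

/-- The number `m` of linear layers. -/
def DeepSets.depth : {a b : ℕ} → DeepSets a b → ℕ
  | _, _, .last _ _ _ => 1
  | _, _, .layer _ _ _ rest => rest.depth + 1

/-- The largest feature dimension, input and output included. -/
def DeepSets.width : {a b : ℕ} → DeepSets a b → ℕ
  | a, b, .last _ _ _ => max a b
  | a, _, .layer _ _ _ rest => max a rest.width

/-! ### Message passing networks with a virtual node -/

/-- The permutation invariant aggregation functions under consideration. -/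
inductive Pooling
  | sum
  | mean

/-- Aggregation of the messages `f j`, `j ∈ s` (no message gives `0`). -/
noncomputable def Pooling.apply {ι : Type} {m : ℕ} (pool : Pooling) (s : Finset ι)
    (f : ι → Fin m → ℝ) : Fin m → ℝ :=
  match pool with
  | .sum => ∑ j ∈ s, f j
  | .mean => (s.card : ℝ)⁻¹ • ∑ j ∈ s, f j

/-- Edge features of dimension `e` on a graph with nodes `1, …, n` and a virtual node. -/
structure EdgeFeatures (e n : ℕ) where
  /-- features of the edges from graph node `j` to the virtual node -/
  toVN : Fin n → Fin e → ℝ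
  /-- features of the edges from the virtual node to graph node `i` -/
  fromVN : Fin n → Fin e → ℝ
  /-- features of the edges from graph node `j` to graph node `i` -/
  graph : Fin n → Fin n → Fin e → ℝ

/-- Parameters of one heterogeneous MPNN + VN layer. Graph node features go from dimension `a` to
`a'`, virtual node features from `p` to `p'`, edge features have dimension `e`. All message
functions `φ` and update functions `γ` are multilayer perceptrons in their concatenated
arguments. -/
structure HeteroLayer (e a p a' p' : ℕ) where
  /-- dimension of the messages sent to the virtual node -/
  mVN : ℕ
  /-- dimension of the messages sent to graph nodes -/
  mGN : ℕ
  /-- message function graph node → virtual node -/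
  φVNGN : MLP (p + a + e) mVN
  /-- update function of the virtual node -/
  γVN : MLP (p + mVN) p'
  /-- message function virtual node → graph node -/
  φGNVN : MLP (a + p + e) mGN
  /-- message function graph node → graph node -/
  φGNGN : MLP (a + a + e) mGN
  /-- update function of the graph nodes -/
  γGN : MLP (a + mGN) a'

namespace HeteroLayer

variable {e a p a' p' n : ℕ}

/-- The new feature of the virtual node, from the old features `X` of the graph nodes and `v` of
the virtual node. -/
noncomputable def evalVN (L : HeteroLayer e a p a' p') (pool : Pooling) (ν : ℝ → ℝ)
    (E : EdgeFeatures e n) (X : Matrix (Fin n) (Fin a) ℝ) (v : Fin p → ℝ) : Fin p' → ℝ :=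
  L.γVN.eval ν (Fin.append v (pool.apply Finset.univ fun j =>
    L.φVNGN.eval ν (Fin.append (Fin.append v (X j)) (E.toVN j))))

open Classical in
/-- The new features of the graph nodes. Node `i` receives one message from the virtual node and
the aggregated messages of its neighbours in `G`. -/
noncomputable def evalGN (L : HeteroLayer e a p a' p') (pool : Pooling) (ν : ℝ → ℝ)
    (G : SimpleGraph (Fin n)) (E : EdgeFeatures e n) (X : Matrix (Fin n) (Fin a) ℝ)
    (v : Fin p → ℝ) : Matrix (Fin n) (Fin a') ℝ :=
  Matrix.of fun i => L.γGN.eval ν (Fin.append (X i)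
    (L.φGNVN.eval ν (Fin.append (Fin.append (X i) v) (E.fromVN i)) +
      pool.apply (Finset.univ.filter fun j => G.Adj i j) fun j =>
        L.φGNGN.eval ν (Fin.append (Fin.append (X i) (X j)) (E.graph j i))))

/-- A simplified layer: all parameters of the graph node → graph node messages are `0`. -/
def IsSimplified (L : HeteroLayer e a p a' p') : Prop := L.φGNGN = MLP.affine 0 0

/-- The largest dimension of a node feature, of a message, or of a hidden layer of a message or
update function. -/
def width (L : HeteroLayer e a p a' p') : ℕ :=
  max (max (max a p) (max a' p')) (max (max L.mVN L.mGN)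
    (max (max L.φVNGN.hiddenWidth L.γVN.hiddenWidth)
      (max L.φGNVN.hiddenWidth (max L.φGNGN.hiddenWidth L.γGN.hiddenWidth))))

/-- The largest depth of a message or update function. -/
def mlpDepth (L : HeteroLayer e a p a' p') : ℕ :=
  max (max L.φVNGN.depth L.γVN.depth) (max L.φGNVN.depth (max L.φGNGN.depth L.γGN.depth))

end HeteroLayer

/-- Parameters of an MPNN + VN, a finite sequence of heterogeneous MPNN + VN layers. -/
inductive MPNNVN (e : ℕ) : ℕ → ℕ → ℕ → ℕ → Type
  | nil {a p : ℕ} : MPNNVN e a p a p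
  | cons {a p b q a' p' : ℕ} (L : HeteroLayer e a p b q) (rest : MPNNVN e b q a' p') :
      MPNNVN e a p a' p'

namespace MPNNVN

variable {e : ℕ}

/-- The final features of the graph nodes, from the features `X` of the graph nodes and `v` of the
virtual node. -/
noncomputable def evalFrom {n : ℕ} (pool : Pooling) (ν : ℝ → ℝ) (G : SimpleGraph (Fin n))
    (E : EdgeFeatures e n) : {a p a' p' : ℕ} → MPNNVN e a p a' p' →
    Matrix (Fin n) (Fin a) ℝ → (Fin p → ℝ) → Matrix (Fin n) (Fin a') ℝ
  | _, _, _, _, .nil, X, _ => X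
  | _, _, _, _, .cons L rest, X, v =>
      rest.evalFrom pool ν G E (L.evalGN pool ν G E X v) (L.evalVN pool ν E X v)

/-- The map computed by the network; the feature of the virtual node is initialised at `0`. -/
noncomputable def eval {n a p a' p' : ℕ} (N : MPNNVN e a p a' p') (pool : Pooling) (ν : ℝ → ℝ)
    (G : SimpleGraph (Fin n)) (E : EdgeFeatures e n) (X : Matrix (Fin n) (Fin a) ℝ) :
    Matrix (Fin n) (Fin a') ℝ :=
  N.evalFrom pool ν G E X 0

/-- All layers are simplified. -/
def IsSimplified : {a p a' p' : ℕ} → MPNNVN e a p a' p' → Prop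
  | _, _, _, _, .nil => True
  | _, _, _, _, .cons L rest => L.IsSimplified ∧ rest.IsSimplified

/-- The number of MPNN + VN layers. -/
def depth : {a p a' p' : ℕ} → MPNNVN e a p a' p' → ℕ
  | _, _, _, _, .nil => 0
  | _, _, _, _, .cons _ rest => rest.depth + 1

/-- The largest dimension of a node feature, of a message, or of a hidden layer of a message or
update function. -/
def width : {a p a' p' : ℕ} → MPNNVN e a p a' p' → ℕ
  | a, p, _, _, .nil => max a p
  | _, _, _, _, .cons L rest => max L.width rest.width

/-- The largest depth of a message or update function. -/
def mlpDepth : {a p a' p' : ℕ} → MPNNVN e a p a' p' → ℕ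
  | _, _, _, _, .nil => 0
  | _, _, _, _, .cons L rest => max L.mlpDepth rest.mlpDepth

end MPNNVN

/-! ### Permutation equivariance and approximation -/

/-- `H` is permutation equivariant over the domain `𝒳`. -/
def PermEquivariantOn {n d d' : ℕ} (𝒳 : Set (Matrix (Fin n) (Fin d) ℝ))
    (H : Matrix (Fin n) (Fin d) ℝ → Matrix (Fin n) (Fin d') ℝ) : Prop :=
  ∀ (σ : Equiv.Perm (Fin n)), ∀ X ∈ 𝒳, X.submatrix σ id ∈ 𝒳 →
    H (X.submatrix σ id) = (H X).submatrix σ id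

/-- The network `N` with ReLU activations is within `ε` of `H` on `𝒳` in the entrywise maximum norm,
on every graph with `n` nodes and for all edge features. -/
def MPNNVN.Within {e n d p d' p' : ℕ} (N : MPNNVN e d p d' p') (pool : Pooling)
    (𝒳 : Set (Matrix (Fin n) (Fin d) ℝ))
    (H : Matrix (Fin n) (Fin d) ℝ → Matrix (Fin n) (Fin d') ℝ) (ε : ℝ) : Prop :=
  ∀ (G : SimpleGraph (Fin n)) (E : EdgeFeatures e n), ∀ X ∈ 𝒳, ∀ i k,
    |H X i k - N.eval pool relu G E X i k| < ε

/-- `H` is approximated arbitrarily well on `𝒳` by simplified MPNN + VN with ReLU activations and at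
most `C` layers, both with width at most `W` (and message and update functions of any depth), and
with message and update functions of depth at most `C` (and any width). -/
def ApproximableByMPNNVN (pool : Pooling) (e C W : ℕ) {n d d' : ℕ}
    (𝒳 : Set (Matrix (Fin n) (Fin d) ℝ))
    (H : Matrix (Fin n) (Fin d) ℝ → Matrix (Fin n) (Fin d') ℝ) : Prop :=
  ∀ ε : ℝ, 0 < ε →
    (∃ (p' : ℕ) (N : MPNNVN e d d d' p'), N.IsSimplified ∧ N.depth ≤ C ∧ N.width ≤ W ∧
      N.Within pool 𝒳 H ε) ∧
    (∃ (p' : ℕ) (N : MPNNVN e d d d' p'), N.IsSimplified ∧ N.depth ≤ C ∧ N.mlpDepth ≤ C ∧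
      N.Within pool 𝒳 H ε)

/-! ### Self-attention and transformers -/

/-- The softmax of each row of a matrix. -/
noncomputable def softmaxRows {n m : ℕ} (M : Matrix (Fin n) (Fin m) ℝ) : Matrix (Fin n) (Fin m) ℝ :=
  Matrix.of fun i j => Real.exp (M i j) / ∑ l, Real.exp (M i l)

/-- The self-attention layer `X ↦ softmax(X W_Q (X W_K)ᵀ) X W_V`. -/
noncomputable def selfAttention {n d k d' : ℕ} (WQ WK : Matrix (Fin d) (Fin k) ℝ)
    (WV : Matrix (Fin d) (Fin d') ℝ) (X : Matrix (Fin n) (Fin d) ℝ) : Matrix (Fin n) (Fin d') ℝ :=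
  softmaxRows ((X * WQ) * (X * WK).transpose) * (X * WV)

/-- Layer normalisation of a vector with gain `g`, bias `b` and stabiliser `δ`. -/
noncomputable def layerNorm {d : ℕ} (δ : ℝ) (g b x : Fin d → ℝ) : Fin d → ℝ :=
  let μ : ℝ := (∑ k, x k) / d
  let v : ℝ := (∑ k, (x k - μ) ^ 2) / d
  fun k => g k * ((x k - μ) / Real.sqrt (v + δ)) + b k

/-- Transformers on tokens in `ℝ^d`: arbitrary compositions of multi-head self-attention layers,
token-wise feed-forward networks with a continuous activation function, token-wise layer
normalisations, and residual connections around any part. -/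
inductive Transformer (d : ℕ) : Type
  | id : Transformer d
  | comp (S T : Transformer d) : Transformer d
  | attention {heads k : ℕ} (WQ WK : Fin heads → Matrix (Fin d) (Fin k) ℝ)
      (WV : Fin heads → Matrix (Fin d) (Fin d) ℝ) : Transformer d
  | feedForward (ν : ℝ → ℝ) (hν : Continuous ν) (f : MLP d d) : Transformer d
  | norm (δ : ℝ) (hδ : 0 < δ) (g b : Fin d → ℝ) : Transformer d
  | residual (T : Transformer d) : Transformer d

/-- The map computed by a transformer. The heads of an attention layer are added; their output
projections are part of the value matrices. -/
noncomputable def Transformer.eval {n d : ℕ} :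
    Transformer d → Matrix (Fin n) (Fin d) ℝ → Matrix (Fin n) (Fin d) ℝ
  | .id, X => X
  | .comp S T, X => S.eval (T.eval X)
  | .attention WQ WK WV, X => ∑ h, selfAttention (WQ h) (WK h) (WV h) X
  | .feedForward ν _ f, X => Matrix.of fun i => f.eval ν (X i)
  | .norm δ _ g b, X => Matrix.of fun i => layerNorm δ g b (X i)
  | .residual T, X => X + T.eval X

/-! ### Density of ReLU networks with one hidden layer -/

/-! A mean layer followed by a broadcast layer turns each `x_i` into `Γ(x_i, mean_j Φ(x_j))` for any
MLPs `Φ` and `Γ` (`MPNNVN.exists_cons_cons`); graph messages vanish and edge features are ignored. A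
DeepSets linear map has this form with `Φ` the identity and `Γ` affine, so two layers per linear map
simulate DeepSets exactly.

For universality, let `Φ` be the vector of monomials of degree at most `2n` in each variable. Its
mean determines the multiset of rows, and together with `x_i` it determines row `i` of `H X` by
equivariance. By compactness that row is a continuous function `ρ` of these pooled features
(`PermEquivariantOn.exists_eq_comp_pooledFeatures`). It remains to approximate `ρ` and the monomials
by ReLU networks. Shallow networks are dense by Stone–Weierstrass, and a shallow network can be
evaluated unit by unit in a deep one of width linear in its input and output dimensions, here of
order `n^d`. Self-attention and transformers are continuous and equivariant, hence special cases. -/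

theorem relu_of_nonneg {t : ℝ} (h : 0 ≤ t) : relu t = t := max_eq_left h

theorem relu_of_nonpos {t : ℝ} (h : t ≤ 0) : relu t = 0 := max_eq_right h

theorem relu_sub_relu_neg (t : ℝ) : relu t - relu (-t) = t := by
  rcases le_total 0 t with h | h
  · rw [relu_of_nonneg h, relu_of_nonpos (by linarith)]; ring
  · rw [relu_of_nonpos h, relu_of_nonneg (by linarith)]; ring

@[fun_prop]
theorem continuous_relu : Continuous relu := continuous_id.max continuous_const

/-- Telescoping sum of ReLU ramps up to the left of `u`. -/
theorem sum_ramp_of_le (a : ℕ → ℝ) (u : ℝ) (N : ℕ) (h : (N : ℝ) ≤ u) :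
    ∑ k ∈ Finset.range N, (a (k + 1) - a k) * (relu (u - k) - relu (u - (k + 1))) =
      a N - a 0 := by
  rw [← Finset.sum_range_sub]
  refine Finset.sum_congr rfl fun k hk => ?_
  have hk' : (k : ℝ) + 1 ≤ N := by exact_mod_cast Finset.mem_range.1 hk
  rw [relu_of_nonneg (by linarith), relu_of_nonneg (by linarith)]
  ring

/-- A sum of ReLU ramps interpolates linearly. -/
theorem sum_ramp (a : ℕ → ℝ) (u : ℝ) (m N : ℕ) (hm : (m : ℝ) ≤ u) (hu : u ≤ m + 1) (hN : m < N) :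
    ∑ k ∈ Finset.range N, (a (k + 1) - a k) * (relu (u - k) - relu (u - (k + 1))) =
      a m - a 0 + (a (m + 1) - a m) * (u - m) := by
  induction N, hN using Nat.le_induction with
  | base =>
    rw [Finset.sum_range_succ, sum_ramp_of_le a u m hm, relu_of_nonneg (by linarith),
      relu_of_nonpos (by linarith), sub_zero]
  | succ N hN ih =>
    have hN' : (m : ℝ) + 1 ≤ N := by exact_mod_cast hN
    rw [Finset.sum_range_succ, ih, relu_of_nonpos (by linarith), relu_of_nonpos (by linarith)]
    ring

/-- Piecewise linear interpolation of a continuous function on the unit interval. -/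
theorem exists_ramp_approx (g : ℝ → ℝ) (hg : Continuous g) {ε : ℝ} (hε : 0 < ε) :
    ∃ N : ℕ, ∀ t ∈ Set.Icc (0 : ℝ) 1,
      |g t - (g 0 + ∑ k ∈ Finset.range N, (g ((k + 1 : ℕ) / N) - g (k / N)) *
        (relu (N * t - k) - relu (N * t - (k + 1))))| < ε := by
  have huc := (isCompact_Icc (a := (0 : ℝ)) (b := 1)).uniformContinuousOn_of_continuous
    hg.continuousOn
  obtain ⟨δ, hδ, H⟩ := Metric.uniformContinuousOn_iff.1 huc ε hε
  obtain ⟨N, hN⟩ := exists_nat_one_div_lt hδ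
  refine ⟨N + 1, fun t ht => ?_⟩
  have hN0 : (0 : ℝ) < ((N + 1 : ℕ) : ℝ) := by positivity
  have hN1 : 1 / ((N + 1 : ℕ) : ℝ) < δ := by exact_mod_cast hN
  set M := N + 1 with hM
  have hu : 0 ≤ M * t := mul_nonneg hN0.le ht.1
  obtain ⟨m, hmM, hm, hm1⟩ : ∃ m : ℕ, m < M ∧ (m : ℝ) ≤ M * t ∧ M * t ≤ m + 1 := by
    rcases lt_or_ge ⌊M * t⌋₊ M with h | h
    · exact ⟨_, h, Nat.floor_le hu, (Nat.lt_floor_add_one _).le⟩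
    -- At `t = 1` the floor is `M`, which indexes no ramp; the last interval, `m = N`, serves
    -- instead.
    · refine ⟨N, by omega, ?_, ?_⟩
      · have h1 : (M : ℝ) ≤ M * t := (Nat.le_floor_iff hu).1 h
        have : (N : ℝ) ≤ M := by exact_mod_cast (by omega : N ≤ M)
        linarith
      · have : (M : ℝ) * t ≤ M := by nlinarith [ht.2]
        simpa [hM] using this
  rw [sum_ramp (fun k => g (k / M)) _ m M hm hm1 hmM]
  have hmM' : (m : ℝ) + 1 ≤ M := by exact_mod_cast hmM
  have e1 : |g t - g (m / M)| < ε := by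
    refine H t ht (m / M) ⟨by positivity, (div_le_one hN0).2 (by linarith)⟩ ?_
    refine lt_of_le_of_lt ?_ hN1
    rw [Real.dist_eq, abs_le]
    constructor <;> field_simp <;> linarith
  have e2 : |g t - g ((m + 1 : ℕ) / M)| < ε := by
    refine H t ht ((m + 1 : ℕ) / M) ⟨by positivity, (div_le_one hN0).2 (by push_cast; linarith)⟩ ?_
    refine lt_of_le_of_lt ?_ hN1
    rw [Real.dist_eq, abs_le]
    push_cast
    constructor <;> field_simp <;> linarith
  -- The interpolation error is a convex combination of the deviations of `g t` from its values at
  -- the two neighbouring grid points.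
  have e3 : g t - (g 0 + (g (m / M) - g ((0 : ℕ) / M) +
      (g ((m + 1 : ℕ) / M) - g (m / M)) * (M * t - m))) =
      (1 - (M * t - m)) * (g t - g (m / M)) + (M * t - m) * (g t - g ((m + 1 : ℕ) / M)) := by
    simp; ring
  rw [e3]
  rw [abs_lt] at e1 e2 ⊢
  have h0 : 0 ≤ M * t - m := by linarith
  have h1 : 0 ≤ 1 - (M * t - m) := by linarith
  constructor <;>
    rcases h0.eq_or_lt with h | h
  · rw [← h]; linarith
  · nlinarith
  · rw [← h]; linarith
  · nlinarith

open Matrix in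
/-- The ridge function `x ↦ relu (w ⬝ x + c)` on `T`. -/
noncomputable def reluRidge {a : ℕ} (T : Set (Fin a → ℝ)) (p : (Fin a → ℝ) × ℝ) : C(T, ℝ) where
  toFun x := relu (p.1 ⬝ᵥ x.1 + p.2)
  continuous_toFun := continuous_relu.comp
    ((continuous_const.dotProduct continuous_subtype_val).add continuous_const)

open Matrix in
/-- The character `w ↦ (x ↦ exp (w ⬝ x))` on `T`. -/
noncomputable def expRidge {a : ℕ} (T : Set (Fin a → ℝ)) :
    Multiplicative (Fin a → ℝ) →* C(T, ℝ) where
  toFun w := ⟨fun x => Real.exp (w.toAdd ⬝ᵥ x.1), Real.continuous_exp.comp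
    (continuous_const.dotProduct continuous_subtype_val)⟩
  map_one' := by ext; simp
  map_mul' v w := by ext; simp [add_dotProduct, Real.exp_add]

open Matrix in
-- On compact `T` the form `w ⬝ x` takes values in some `[-R, R]`. Rescaling to the unit interval
-- reduces the claim to interpolating a function of one variable by ramps, and a ramp in `w ⬝ x` is
-- a difference of two ridge functions.
theorem expRidge_mem_closure {a : ℕ} (T : Set (Fin a → ℝ)) [CompactSpace T]
    (w : Multiplicative (Fin a → ℝ)) :
    expRidge T w ∈ (Submodule.span ℝ (Set.range (reluRidge T))).topologicalClosure := by
  obtain ⟨R, hR, hb⟩ : ∃ R : ℝ, 0 < R ∧ ∀ x : T, |w.toAdd ⬝ᵥ x.1| ≤ R := by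
    let f : C(T, ℝ) := ⟨fun x => w.toAdd ⬝ᵥ x.1,
      continuous_const.dotProduct continuous_subtype_val⟩
    exact ⟨‖f‖ + 1, by positivity, fun x => (f.norm_coe_le_norm x).trans (by linarith)⟩
  rw [← SetLike.mem_coe, Submodule.topologicalClosure_coe, Metric.mem_closure_iff]
  intro ε hε
  let g : ℝ → ℝ := fun t => Real.exp (2 * R * t - R)
  obtain ⟨N, hN⟩ := exists_ramp_approx g (by fun_prop) hε
  let r : ℝ → C(T, ℝ) := fun c => reluRidge T ((N / (2 * R)) • w.toAdd, N / 2 - c)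
  have hr : ∀ c, r c ∈ Submodule.span ℝ (Set.range (reluRidge T)) :=
    fun c => Submodule.subset_span ⟨_, rfl⟩
  -- Zero weight and bias `1` give the constant function `relu 1 = 1`.
  refine ⟨g 0 • reluRidge T (0, 1) + ∑ k ∈ Finset.range N,
    (g ((k + 1 : ℕ) / N) - g (k / N)) • (r k - r (k + 1)), ?_, ?_⟩
  · refine Submodule.add_mem _ (Submodule.smul_mem _ _ (Submodule.subset_span ⟨_, rfl⟩))
      (Submodule.sum_mem _ fun k _ => Submodule.smul_mem _ _ (Submodule.sub_mem _ (hr _) (hr _)))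
  · rw [ContinuousMap.dist_lt_iff hε]
    intro x
    have hx := abs_le.1 (hb x)
    have := hN ((w.toAdd ⬝ᵥ x.1 + R) / (2 * R))
      ⟨div_nonneg (by linarith) (by linarith), (div_le_one (by linarith)).2 (by linarith)⟩
    rw [Real.dist_eq]
    convert this using 2
    have h1 : relu 1 = 1 := relu_of_nonneg zero_le_one
    have h2 : g ((w.toAdd ⬝ᵥ x.1 + R) / (2 * R)) = expRidge T w x := by
      simp only [g, expRidge]
      change _ = Real.exp _
      congr 1
      field_simp
      ring
    have h3 : ∀ c : ℝ, r c x = relu (N * ((w.toAdd ⬝ᵥ x.1 + R) / (2 * R)) - c) := by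
      intro c
      simp only [r, reluRidge]
      change relu _ = relu _
      congr 1
      simp only [smul_dotProduct, smul_eq_mul]
      field_simp
      ring
    have h4 : reluRidge T (0, 1) x = 1 := by
      change relu _ = 1
      simp [h1]
    simp only [ContinuousMap.add_apply, ContinuousMap.smul_apply, ContinuousMap.sum_apply,
      ContinuousMap.sub_apply, smul_eq_mul, h2, h3, h4, mul_one]

open Matrix in
-- Ridge functions are not closed under products, but exponentials are: the algebra they generate is
-- just their span. It separates points, so Stone–Weierstrass applies to it, and it lies in the
-- closed span of the ridge functions.
theorem topologicalClosure_span_reluRidge {a : ℕ} (T : Set (Fin a → ℝ)) [CompactSpace T] :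
    (Submodule.span ℝ (Set.range (reluRidge T))).topologicalClosure = ⊤ := by
  let A : Subalgebra ℝ C(T, ℝ) := Algebra.adjoin ℝ (MonoidHom.mrange (expRidge T) : Set C(T, ℝ))
  have hA : A.topologicalClosure = ⊤ := by
    refine ContinuousMap.subalgebra_topologicalClosure_eq_top_of_separatesPoints A ?_
    intro x y hxy
    obtain ⟨k, hk⟩ : ∃ k, x.1 k ≠ y.1 k := Function.ne_iff.1 fun h => hxy (Subtype.ext h)
    refine ⟨_, ⟨expRidge T (Multiplicative.ofAdd (Pi.single k 1)),
      Algebra.subset_adjoin ⟨_, rfl⟩, rfl⟩, ?_⟩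
    change Real.exp _ ≠ Real.exp _
    simpa using hk
  have hsub : Subalgebra.toSubmodule A ≤
      (Submodule.span ℝ (Set.range (reluRidge T))).topologicalClosure := by
    rw [Algebra.adjoin_eq_span, Submonoid.closure_eq, Submodule.span_le]
    rintro _ ⟨w, rfl⟩
    exact expRidge_mem_closure T w
  rw [eq_top_iff]
  intro f _
  have hf : f ∈ closure (A : Set C(T, ℝ)) := by
    rw [← Subalgebra.topologicalClosure_coe, hA]; trivial
  exact closure_minimal hsub (Submodule.isClosed_topologicalClosure _) hf

open Matrix in
/-- Universal approximation: ReLU networks with one hidden layer are dense on compact sets. -/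
theorem exists_shallow_approx {a b : ℕ} {T : Set (Fin a → ℝ)} (hT : IsCompact T)
    (f : (Fin a → ℝ) → Fin b → ℝ) (hf : ContinuousOn f T) {ε : ℝ} (hε : 0 < ε) :
    ∃ (N : ℕ) (W : Matrix (Fin N) (Fin a) ℝ) (c : Fin N → ℝ) (A : Matrix (Fin b) (Fin N) ℝ),
      ∀ x ∈ T, ∀ k, |f x k - (A *ᵥ fun j => relu ((W *ᵥ x + c) j)) k| < ε := by
  have : CompactSpace T := isCompact_iff_compactSpace.1 hT
  have key : ∀ k : Fin b, ∃ (m : ℕ) (α : Fin m → ℝ) (p : Fin m → (Fin a → ℝ) × ℝ),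
      ∀ x ∈ T, |f x k - ∑ j, α j * relu ((p j).1 ⬝ᵥ x + (p j).2)| < ε := by
    intro k
    let F : C(T, ℝ) := ⟨fun x => f x.1 k,
      (continuous_apply k).comp (continuousOn_iff_continuous_domRestrict.1 hf)⟩
    have hF : F ∈ (Submodule.span ℝ (Set.range (reluRidge T))).topologicalClosure := by
      rw [topologicalClosure_span_reluRidge]; trivial
    rw [← SetLike.mem_coe, Submodule.topologicalClosure_coe, Metric.mem_closure_iff] at hF
    obtain ⟨g, hg, hd⟩ := hF ε hε
    obtain ⟨m, α, p, rfl⟩ := Submodule.mem_span_set'.1 hg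
    choose q hq using fun j => (p j).2
    refine ⟨m, α, q, fun x hx => ?_⟩
    have := (ContinuousMap.dist_lt_iff hε).1 hd ⟨x, hx⟩
    simp only [← hq, Real.dist_eq, ContinuousMap.sum_apply, ContinuousMap.smul_apply,
      smul_eq_mul] at this
    exact this
  choose m α p h using key
  -- The hidden units for all output coordinates are placed side by side; output `k` reads only its
  -- own block.
  let e := Fintype.equivFin (Σ k : Fin b, Fin (m k))
  refine ⟨_, Matrix.of fun i => (p (e.symm i).1 (e.symm i).2).1,
    fun i => (p (e.symm i).1 (e.symm i).2).2,
    Matrix.of fun k i => if (e.symm i).1 = k then α (e.symm i).1 (e.symm i).2 else 0, ?_⟩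
  intro x hx k
  convert h k x hx using 3
  simp only [Matrix.mulVec, dotProduct, Matrix.of_apply, Pi.add_apply]
  rw [← Equiv.sum_comp e, Fintype.sum_sigma, Finset.sum_eq_single k]
  · refine Finset.sum_congr rfl fun j _ => ?_
    rw [e.symm_apply_apply, if_pos rfl]
  · intro l _ hl
    simp [hl]
  · simp

/-! ### Affine maps and multilayer perceptrons -/

open Matrix in
/-- `g` is an affine functional. -/
def IsAffineFun {a : ℕ} (g : (Fin a → ℝ) → ℝ) : Prop :=
  ∃ (w : Fin a → ℝ) (c : ℝ), ∀ x, g x = w ⬝ᵥ x + c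

namespace IsAffineFun

variable {a : ℕ} {f g : (Fin a → ℝ) → ℝ}

open Matrix

theorem const (c : ℝ) : IsAffineFun fun _ : Fin a → ℝ => c := ⟨0, c, by simp⟩

theorem coord (i : Fin a) : IsAffineFun fun x : Fin a → ℝ => x i :=
  ⟨Pi.single i 1, 0, by simp⟩

theorem add (hf : IsAffineFun f) (hg : IsAffineFun g) : IsAffineFun fun x => f x + g x := by
  obtain ⟨v, b, hv⟩ := hf
  obtain ⟨w, c, hw⟩ := hg
  exact ⟨v + w, b + c, fun x => by simp only [hv, hw, add_dotProduct]; ring⟩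

theorem const_mul (r : ℝ) (hf : IsAffineFun f) : IsAffineFun fun x => r * f x := by
  obtain ⟨v, b, hv⟩ := hf
  exact ⟨r • v, r * b, fun x => by simp only [hv, smul_dotProduct, smul_eq_mul]; ring⟩

theorem neg (hf : IsAffineFun f) : IsAffineFun fun x => -f x := by
  simpa using hf.const_mul (-1)

theorem sub (hf : IsAffineFun f) (hg : IsAffineFun g) : IsAffineFun fun x => f x - g x := by
  simpa [sub_eq_add_neg] using hf.add hg.neg

theorem sum {ι : Type*} (s : Finset ι) {F : ι → (Fin a → ℝ) → ℝ} (hF : ∀ i, IsAffineFun (F i)) :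
    IsAffineFun fun x => ∑ i ∈ s, F i x := by
  classical
  induction s using Finset.induction_on with
  | empty => simpa using const 0
  | insert i s hi ih => simpa [Finset.sum_insert hi] using (hF i).add ih

end IsAffineFun

/-- A map is affine if all its coordinates are. -/
theorem exists_mulVec_add_eq {a b : ℕ} (f : (Fin a → ℝ) → Fin b → ℝ)
    (hf : ∀ k, IsAffineFun fun x => f x k) :
    ∃ (W : Matrix (Fin b) (Fin a) ℝ) (c : Fin b → ℝ), ∀ x, W.mulVec x + c = f x := by
  choose W c h using hf
  exact ⟨Matrix.of W, c, fun x => funext fun k => (h k x).symm⟩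

namespace MLP

variable {a b : ℕ}

theorem exists_affine (f : (Fin a → ℝ) → Fin b → ℝ) (hf : ∀ k, IsAffineFun fun x => f x k) :
    ∃ m : MLP a b, m.hiddenWidth = 0 ∧ m.depth = 1 ∧ ∀ ν x, m.eval ν x = f x := by
  obtain ⟨W, c, h⟩ := exists_mulVec_add_eq f hf
  exact ⟨.affine W c, rfl, rfl, fun _ x => h x⟩

/-- No activation follows the last affine map of an MLP, so an identity map is appended. -/
theorem exists_affine_map (f : (Fin a → ℝ) → Fin b → ℝ) (hf : ∀ k, IsAffineFun fun x => f x k) :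
    ∃ m : MLP a b, m.hiddenWidth = b ∧ m.depth = 2 ∧ ∀ ν x, m.eval ν x = fun k => ν (f x k) := by
  obtain ⟨W, c, h⟩ := exists_mulVec_add_eq f hf
  exact ⟨.layer W c (.affine 1 0), by simp [hiddenWidth], rfl, fun _ x => by
    simp only [eval, h, Matrix.one_mulVec, add_zero]⟩

theorem exists_comp_affine {a' : ℕ} (m : MLP a b) (g : (Fin a' → ℝ) → Fin a → ℝ)
    (hg : ∀ k, IsAffineFun fun x => g x k) :
    ∃ m' : MLP a' b, m'.hiddenWidth = m.hiddenWidth ∧ m'.depth = m.depth ∧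
      ∀ ν x, m'.eval ν x = m.eval ν (g x) := by
  obtain ⟨V, v, h⟩ := exists_mulVec_add_eq g hg
  cases m with
  | affine W c =>
    refine ⟨.affine (W * V) (W.mulVec v + c), rfl, rfl, fun ν x => ?_⟩
    simp only [eval, ← h, Matrix.mulVec_add, Matrix.mulVec_mulVec, add_assoc]
  | layer W c rest =>
    refine ⟨.layer (W * V) (W.mulVec v + c) rest, rfl, rfl, fun ν x => ?_⟩
    simp only [eval, ← h, Matrix.mulVec_add, Matrix.mulVec_mulVec, add_assoc]

theorem continuous_eval {ν : ℝ → ℝ} (hν : Continuous ν) (m : MLP a b) :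
    Continuous (m.eval ν) := by
  induction m with
  | affine W c => exact (continuous_const.matrix_mulVec continuous_id).add continuous_const
  | layer W c rest ih =>
    refine ih.comp (continuous_pi fun k => hν.comp ((continuous_apply k).comp ?_))
    exact (continuous_const.matrix_mulVec continuous_id).add continuous_const

/-- The units of a ReLU network with one hidden layer can be computed one after the other by a
deep network which carries along the positive and negative parts of the input and of the partial
sums. -/
theorem exists_narrow_eq_shallow {N : ℕ} (W : Matrix (Fin N) (Fin a) ℝ) (c : Fin N → ℝ)
    (A : Matrix (Fin b) (Fin N) ℝ) :
    ∃ m : MLP a b, m.hiddenWidth ≤ 2 * a + 2 * b + 1 ∧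
      ∀ x, m.eval relu x = A.mulVec fun j => relu ((W.mulVec x + c) j) := by
  let pre : (Fin a → ℝ) → ℝ → (Fin b → ℝ) → Fin a ⊕ Fin a ⊕ Unit ⊕ Fin b ⊕ Fin b → ℝ :=
    fun x u y => Sum.elim x (Sum.elim (-x) (Sum.elim (fun _ => u) (Sum.elim y (-y))))
  obtain ⟨h, hcard, ⟨e⟩⟩ : ∃ h, h = 2 * a + 2 * b + 1 ∧
      Nonempty (Fin a ⊕ Fin a ⊕ Unit ⊕ Fin b ⊕ Fin b ≃ Fin h) :=
    ⟨_, rfl, ⟨Fintype.equivFinOfCardEq (by simp; ring)⟩⟩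
  let enc : (Fin a → ℝ) → ℝ → (Fin b → ℝ) → Fin h → ℝ :=
    fun x u y i => relu (pre x u y (e.symm i))
  let dx : (Fin h → ℝ) → Fin a → ℝ := fun s i => s (e (.inl i)) - s (e (.inr (.inl i)))
  let du : (Fin h → ℝ) → ℝ := fun s => s (e (.inr (.inr (.inl ()))))
  let dy : (Fin h → ℝ) → Fin b → ℝ := fun s i =>
    s (e (.inr (.inr (.inr (.inl i))))) - s (e (.inr (.inr (.inr (.inr i)))))
  have hdx : ∀ x u y, dx (enc x u y) = x := fun x u y => funext fun i => by
    simp [dx, enc, pre, relu_sub_relu_neg]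
  have hdu : ∀ x u y, du (enc x u y) = relu u := fun x u y => by simp [du, enc, pre]
  have hdy : ∀ x u y, dy (enc x u y) = y := fun x u y => funext fun i => by
    simp [dy, enc, pre, relu_sub_relu_neg]
  have adx : ∀ i, IsAffineFun fun s => dx s i := fun i => (IsAffineFun.coord _).sub (.coord _)
  have adu : IsAffineFun du := .coord _
  have ady : ∀ i, IsAffineFun fun s => dy s i := fun i => (IsAffineFun.coord _).sub (.coord _)
  have apre : ∀ {q : ℕ} {fx : (Fin q → ℝ) → Fin a → ℝ} {fu : (Fin q → ℝ) → ℝ}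
      {fy : (Fin q → ℝ) → Fin b → ℝ}, (∀ i, IsAffineFun fun s => fx s i) → IsAffineFun fu →
      (∀ i, IsAffineFun fun s => fy s i) →
      ∀ i, IsAffineFun fun s => pre (fx s) (fu s) (fy s) (e.symm i) := by
    intro q fx fu fy hx hu hy i
    rcases e.symm i with i | i | i | i | i
    exacts [hx i, (hx i).neg, hu, hy i, (hy i).neg]
  -- `l` lists the units still to be computed. The unit in register `u` is pending: its activation
  -- is available only one layer later, where it is added to `y` with the output weights `α`.
  have main : ∀ (l : List (Fin N)) (α : Fin b → ℝ), ∃ m : MLP h b, m.hiddenWidth ≤ h ∧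
      ∀ x u y, m.eval relu (enc x u y) = fun k => y k + α k * relu u +
        (l.map fun j => A k j * relu ((W.mulVec x + c) j)).sum := by
    intro l
    induction l with
    | nil =>
      intro α
      obtain ⟨m, h1, -, h3⟩ := exists_affine (fun (s : Fin h → ℝ) k => dy s k + α k * du s)
        fun k => (ady k).add (adu.const_mul _)
      exact ⟨m, by omega, fun x u y => by simp [h3, hdy, hdu]⟩
    | cons j l ih =>
      intro α
      obtain ⟨m, h1, h2⟩ := ih fun k => A k j
      obtain ⟨V, v, hV⟩ := exists_mulVec_add_eq (fun (s : Fin h → ℝ) i =>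
        pre (dx s) ((∑ i, W j i * dx s i) + c j) (fun k => dy s k + α k * du s) (e.symm i))
        (apre adx ((IsAffineFun.sum _ fun i => (adx i).const_mul _).add (.const _))
          fun k => (ady k).add (adu.const_mul _))
      refine ⟨.layer V v m, by simp [hiddenWidth, h1], fun x u y => ?_⟩
      rw [eval, hV]
      simp only [hdx, hdu, hdy]
      refine (h2 x _ _).trans (funext fun k => ?_)
      simp only [List.map_cons, List.sum_cons, Pi.add_apply, Matrix.mulVec, dotProduct]
      ring
  -- No unit is pending at the start, hence output weights `0`.
  obtain ⟨m, h1, h2⟩ := main (List.finRange N) 0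
  obtain ⟨V, v, hV⟩ := exists_mulVec_add_eq (fun (x : Fin a → ℝ) i => pre x 0 0 (e.symm i))
    (apre (fun i => .coord i) (.const 0) fun k => .const 0)
  refine ⟨.layer V v m, max_le hcard.le (h1.trans hcard.le), fun x => ?_⟩
  rw [eval, hV]
  refine (h2 x 0 0).trans (funext fun k => ?_)
  simp only [← Fin.sum_univ_def, Matrix.mulVec, dotProduct, Pi.zero_apply, zero_mul, zero_add]

/-- Universal approximation on compact sets by deep narrow and by shallow wide ReLU networks. -/
theorem exists_approx {T : Set (Fin a → ℝ)} (hT : IsCompact T)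
    (f : (Fin a → ℝ) → Fin b → ℝ) (hf : ContinuousOn f T) {ε : ℝ} (hε : 0 < ε) :
    (∃ m : MLP a b, m.hiddenWidth ≤ 2 * a + 2 * b + 1 ∧
      ∀ x ∈ T, ∀ k, |f x k - m.eval relu x k| < ε) ∧
    (∃ m : MLP a b, m.depth ≤ 2 ∧ ∀ x ∈ T, ∀ k, |f x k - m.eval relu x k| < ε) := by
  obtain ⟨N, W, c, A, h⟩ := exists_shallow_approx hT f hf hε
  constructor
  · obtain ⟨m, h1, h2⟩ := exists_narrow_eq_shallow W c A
    exact ⟨m, h1, fun x hx k => by rw [h2]; exact h x hx k⟩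
  · exact ⟨.layer W c (.affine A 0), le_rfl, fun x hx k => by simpa [eval] using h x hx k⟩

end MLP

/-! ### Separation of multisets by monomials -/

theorem sum_eval_eq_of_sum_monomial_eq {n d D : ℕ} (X Y : Fin n → Fin d → ℝ)
    (h : ∀ α : Fin d → Fin (D + 1), ∑ j, ∏ i, X j i ^ (α i : ℕ) = ∑ j, ∏ i, Y j i ^ (α i : ℕ))
    (p : MvPolynomial (Fin d) ℝ) (hp : p.totalDegree ≤ D) :
    ∑ j, MvPolynomial.eval (X j) p = ∑ j, MvPolynomial.eval (Y j) p := by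
  simp only [MvPolynomial.eval_eq']
  rw [Finset.sum_comm, Finset.sum_comm (γ := Fin n)]
  refine Finset.sum_congr rfl fun s hs => ?_
  rw [← Finset.mul_sum, ← Finset.mul_sum]
  have hle : ∀ i, s i < D + 1 := fun i => by
    have h1 := MvPolynomial.le_totalDegree hs
    rw [Finsupp.sum_fintype _ _ fun _ => rfl] at h1
    have h2 := Finset.single_le_sum (f := fun i => s i) (fun _ _ => Nat.zero_le _)
      (Finset.mem_univ i)
    exact Nat.lt_succ_of_le (h2.trans (h1.trans hp))
  rw [show ∑ j, ∏ i, X j i ^ s i = ∑ j, ∏ i, Y j i ^ s i from h fun i => ⟨s i, hle i⟩]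

/-- Two families of `n` points with the same sums of monomials of degree at most `2n` in each
variable agree up to a permutation. -/
theorem exists_perm_of_sum_monomial_eq {n d : ℕ} (X Y : Fin n → Fin d → ℝ)
    (h : ∀ α : Fin d → Fin (2 * n + 1),
      ∑ j, ∏ i, X j i ^ (α i : ℕ) = ∑ j, ∏ i, Y j i ^ (α i : ℕ)) :
    ∃ σ : Equiv.Perm (Fin n), ∀ k, X (σ k) = Y k := by
  classical
  -- A permutation exists once every point has the same multiplicity in both families.
  suffices hc : ∀ z, Fintype.card {j // Y j = z} = Fintype.card {j // X j = z} from
    ⟨Equiv.ofFiberEquiv fun z => Fintype.equivOfCardEq (hc z), fun k => Equiv.ofFiberEquiv_map _ k⟩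
  intro z
  let S := (Finset.univ.image X ∪ Finset.univ.image Y).erase z
  have hS : S.card ≤ 2 * n := by
    refine (Finset.card_erase_le).trans ((Finset.card_union_le _ _).trans ?_)
    have h1 := Finset.card_image_le (s := Finset.univ) (f := X)
    have h2 := Finset.card_image_le (s := Finset.univ) (f := Y)
    simp only [Finset.card_univ, Fintype.card_fin] at h1 h2
    omega
  have hk : ∀ s : S, ∃ k, z k ≠ s.1 k := fun s =>
    Function.ne_iff.1 (Finset.ne_of_mem_erase s.2).symm
  choose k hk using hk
  -- One linear factor for each of the at most `2n` other points: `p` vanishes at all of them but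
  -- not at `z`, so its sum over a family is the multiplicity of `z` times `p(z)`.
  let p : MvPolynomial (Fin d) ℝ :=
    ∏ s : S, (MvPolynomial.X (k s) - MvPolynomial.C (s.1 (k s)))
  have hpd : p.totalDegree ≤ 2 * n := by
    refine (MvPolynomial.totalDegree_finsetProd _ _).trans ((Finset.sum_le_card_nsmul _ _ 1
      fun s _ => ?_).trans (by simpa using hS))
    refine (MvPolynomial.totalDegree_sub _ _).trans ?_
    simp
  have hpz : MvPolynomial.eval z p ≠ 0 := by
    simp only [p, map_prod, map_sub, MvPolynomial.eval_X, MvPolynomial.eval_C]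
    exact Finset.prod_ne_zero_iff.2 fun s _ => sub_ne_zero.2 (hk s)
  have hp0 : ∀ s ∈ S, MvPolynomial.eval s p = 0 := fun s hs => by
    simp only [p, map_prod, map_sub, MvPolynomial.eval_X, MvPolynomial.eval_C]
    exact Finset.prod_eq_zero (Finset.mem_univ ⟨s, hs⟩) (by simp)
  have hsum : ∀ Z : Fin n → Fin d → ℝ, (∀ j, Z j ≠ z → Z j ∈ S) →
      ∑ j, MvPolynomial.eval (Z j) p = Fintype.card {j // Z j = z} * MvPolynomial.eval z p := by
    intro Z hZ
    rw [Fintype.card_subtype, ← nsmul_eq_mul, ← Finset.sum_const, Finset.sum_filter]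
    refine Finset.sum_congr rfl fun j _ => ?_
    split_ifs with hj
    · rw [hj]
    · exact hp0 _ (hZ j hj)
  have := sum_eval_eq_of_sum_monomial_eq X Y h p hpd
  rw [hsum X fun j hj => by simp [S, hj], hsum Y fun j hj => by simp [S, hj]] at this
  exact_mod_cast (mul_right_cancel₀ hpz this).symm

/-- All monomials of degree at most `2n` in each variable. -/
noncomputable def monomialFeatures (n d : ℕ) (x : Fin d → ℝ) : Fin ((2 * n + 1) ^ d) → ℝ :=
  fun l => ∏ i, x i ^ (finFunctionFinEquiv.symm l i : ℕ)

theorem continuous_monomialFeatures (n d : ℕ) : Continuous (monomialFeatures n d) :=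
  continuous_pi fun _ => continuous_finsetProd _ fun i _ => (continuous_apply i).pow _

/-- The features of a node together with the mean of the monomial features of all nodes. -/
noncomputable def pooledFeatures {n d : ℕ} (X : Matrix (Fin n) (Fin d) ℝ) (i : Fin n) :
    Fin (d + (2 * n + 1) ^ d) → ℝ :=
  Fin.append (X i) ((n : ℝ)⁻¹ • ∑ j, monomialFeatures n d (X j))

theorem continuous_fin_append {ι : Type*} [TopologicalSpace ι] {a b : ℕ} {f : ι → Fin a → ℝ}
    {g : ι → Fin b → ℝ} (hf : Continuous f) (hg : Continuous g) :
    Continuous fun x => Fin.append (f x) (g x) :=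
  (Fin.appendHomeomorph a b (X := ℝ)).continuous.comp (hf.prodMk hg)

theorem continuous_pooledFeatures {n d : ℕ} (i : Fin n) :
    Continuous fun X : Matrix (Fin n) (Fin d) ℝ => pooledFeatures X i :=
  have h : Continuous fun X : Matrix (Fin n) (Fin d) ℝ => ∑ j, monomialFeatures n d (X j) :=
    continuous_finsetSum _ fun j _ => (continuous_monomialFeatures n d).comp (continuous_apply j)
  continuous_fin_append (continuous_apply i) (h.const_smul (n : ℝ)⁻¹)

theorem PermEquivariantOn.eq_of_pooledFeatures_eq {n d d' : ℕ}
    {𝒳 : Set (Matrix (Fin n) (Fin d) ℝ)} {H : Matrix (Fin n) (Fin d) ℝ → Matrix (Fin n) (Fin d') ℝ}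
    (hH : PermEquivariantOn 𝒳 H) {X Y : Matrix (Fin n) (Fin d) ℝ} (hX : X ∈ 𝒳) (hY : Y ∈ 𝒳)
    {i j : Fin n} (h : pooledFeatures X i = pooledFeatures Y j) : H X i = H Y j := by
  obtain ⟨h1, h2⟩ := Prod.ext_iff.1 ((Fin.appendEquiv _ _).injective
    (a₁ := (_, _)) (a₂ := (_, _)) h)
  have hn : (n : ℝ)⁻¹ ≠ 0 := inv_ne_zero (Nat.cast_ne_zero.2 (Fin.pos i).ne')
  have h3 := smul_right_injective _ hn h2
  obtain ⟨τ, hτ⟩ := exists_perm_of_sum_monomial_eq X Y fun α => by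
    have := congrFun h3 (finFunctionFinEquiv α)
    simpa [monomialFeatures, Finset.sum_apply] using this
  -- `τ` carries `X` to `Y` but need not send `j` to `i`. Since rows `τ j` and `i` of `X` agree,
  -- swapping them afterwards is harmless and gives `σ j = i`.
  let σ : Equiv.Perm (Fin n) := τ.trans (Equiv.swap (τ j) i)
  have hτj : X (τ j) = X i := (hτ j).trans h1.symm
  have hσ : X.submatrix σ id = Y := by
    funext k
    change X (Equiv.swap (τ j) i (τ k)) = Y k
    rw [← hτ k]
    rcases eq_or_ne (τ k) (τ j) with hk | hk
    · rw [hk, Equiv.swap_apply_left, hτj]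
    rcases eq_or_ne (τ k) i with hk' | hk'
    · rw [hk', Equiv.swap_apply_right, hτj]
    · rw [Equiv.swap_apply_of_ne_of_ne hk hk']
  have := hH σ X hX (hσ ▸ hY)
  rw [hσ] at this
  rw [this]
  change H X i = H X (σ j)
  simp [σ]

/-- A continuous equivariant map factors through the pooled features. -/
theorem PermEquivariantOn.exists_eq_comp_pooledFeatures {n d d' : ℕ}
    {𝒳 : Set (Matrix (Fin n) (Fin d) ℝ)} {H : Matrix (Fin n) (Fin d) ℝ → Matrix (Fin n) (Fin d') ℝ}
    (hH : PermEquivariantOn 𝒳 H) (h𝒳 : IsCompact 𝒳) (hc : ContinuousOn H 𝒳) :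
    ∃ (T : Set (Fin (d + (2 * n + 1) ^ d) → ℝ)) (ρ : (Fin (d + (2 * n + 1) ^ d) → ℝ) → Fin d' → ℝ),
      IsCompact T ∧ ContinuousOn ρ T ∧
      ∀ X ∈ 𝒳, ∀ i, pooledFeatures X i ∈ T ∧ ρ (pooledFeatures X i) = H X i := by
  have : CompactSpace 𝒳 := isCompact_iff_compactSpace.1 h𝒳
  let q : 𝒳 × Fin n → Fin (d + (2 * n + 1) ^ d) → ℝ := fun z => pooledFeatures z.1.1 z.2
  have hq : Continuous q := continuous_prod_of_discrete_right.2 fun i =>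
    (continuous_pooledFeatures i).comp continuous_subtype_val
  let g : 𝒳 × Fin n → Fin d' → ℝ := fun z => H z.1.1 z.2
  have hg : Continuous g := continuous_prod_of_discrete_right.2 fun i =>
    (continuous_apply i).comp (continuousOn_iff_continuous_domRestrict.1 hc)
  have hfac : ∀ z w, q z = q w → g z = g w := fun z w h =>
    hH.eq_of_pooledFeatures_eq z.1.2 w.1.2 h
  refine ⟨Set.range q, Function.extend q g 0, isCompact_range hq, ?_, fun X hX i =>
    ⟨⟨(⟨X, hX⟩, i), rfl⟩, Function.FactorsThrough.extend_apply (f := q) (g := g)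
      (fun z w h => hfac z w h) 0 (⟨X, hX⟩, i)⟩⟩
  rw [continuousOn_iff_continuous_domRestrict]
  have hq' : Continuous (Set.rangeFactorization q) := hq.subtype_mk _
  -- A continuous surjection from a compact space onto a Hausdorff space is a quotient map, so
  -- continuity of the factor can be tested on `𝒳 × Fin n`.
  rw [(hq'.isClosedMap.isQuotientMap hq' Set.rangeFactorization_surjective).continuous_iff]
  convert hg using 1
  funext z
  exact Function.FactorsThrough.extend_apply (f := q) (g := g) (fun z w h => hfac z w h) 0 z

/-! ### Simplified MPNN + VN -/

/-- The virtual node always hears from all `n` nodes, so sum and mean differ by a fixed factor,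
which its update function absorbs. -/
theorem Pooling.exists_smul_apply_eq_mean (pool : Pooling) (n : ℕ) :
    ∃ κ : ℝ, ∀ {m : ℕ} (f : Fin n → Fin m → ℝ),
      κ • pool.apply Finset.univ f = (n : ℝ)⁻¹ • ∑ j, f j := by
  cases pool with
  | sum => exact ⟨(n : ℝ)⁻¹, fun f => rfl⟩
  | mean => exact ⟨1, fun f => by simp [Pooling.apply]⟩

theorem Pooling.apply_zero {ι : Type} {m : ℕ} (pool : Pooling) (s : Finset ι) :
    pool.apply s (fun _ => (0 : Fin m → ℝ)) = 0 := by
  cases pool <;> simp [Pooling.apply]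

namespace HeteroLayer

variable {a p m b : ℕ}

/-- A layer which stores in the virtual node the mean of `Φ` over all graph nodes. -/
theorem exists_mean (pool : Pooling) (e n p : ℕ) (Φ : MLP a m) :
    ∃ L : HeteroLayer e a p a m, L.IsSimplified ∧
      L.width ≤ max (max a p) (max m Φ.hiddenWidth) ∧ L.mlpDepth ≤ max 1 Φ.depth ∧
      ∀ (ν : ℝ → ℝ) (G : SimpleGraph (Fin n)) (E : EdgeFeatures e n) (X : Matrix (Fin n) (Fin a) ℝ)
        (v : Fin p → ℝ), L.evalGN pool ν G E X v = X ∧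
          L.evalVN pool ν E X v = (n : ℝ)⁻¹ • ∑ j, Φ.eval ν (X j) := by
  obtain ⟨κ, hκ⟩ := pool.exists_smul_apply_eq_mean n
  obtain ⟨φ, hφ1, hφ2, hφ⟩ := Φ.exists_comp_affine
    (fun (x : Fin (p + a + e) → ℝ) k => x (Fin.castAdd e (Fin.natAdd p k))) fun k => .coord _
  obtain ⟨γ, hγ1, hγ2, hγ⟩ := MLP.exists_affine
    (fun (x : Fin (p + m) → ℝ) k => κ * x (Fin.natAdd p k))
    fun k => (IsAffineFun.coord _).const_mul _
  obtain ⟨η, hη1, hη2, hη⟩ := MLP.exists_affine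
    (fun (x : Fin (a + 0) → ℝ) k => x (Fin.castAdd 0 k)) fun k => .coord _
  refine ⟨⟨m, 0, φ, γ, .affine 0 0, .affine 0 0, η⟩, rfl, ?_, ?_, fun ν G E X v => ⟨?_, ?_⟩⟩
  · simp only [width, hφ1, hγ1, hη1, MLP.hiddenWidth]
    omega
  · simp only [mlpDepth, hφ2, hγ2, hη2, MLP.depth]
    omega
  · funext i k
    simp only [evalGN, hη, Matrix.of_apply]
    exact Fin.append_left _ _ k
  · rw [← hκ]
    funext k
    simp [evalVN, hγ, hφ]

/-- A layer which applies `Γ` to the features of each graph node and of the virtual node. -/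
theorem exists_broadcast (pool : Pooling) (e n : ℕ) (Γ : MLP (a + m) b) :
    ∃ L : HeteroLayer e a m b 0, L.IsSimplified ∧
      L.width ≤ max (max a m) (max b Γ.hiddenWidth) ∧ L.mlpDepth ≤ max 1 Γ.depth ∧
      ∀ (ν : ℝ → ℝ) (G : SimpleGraph (Fin n)) (E : EdgeFeatures e n) (X : Matrix (Fin n) (Fin a) ℝ)
        (v : Fin m → ℝ), L.evalGN pool ν G E X v =
          Matrix.of fun i => Γ.eval ν (Fin.append (X i) v) := by
  obtain ⟨φ, hφ1, hφ2, hφ⟩ := MLP.exists_affine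
    (fun (x : Fin (a + m + e) → ℝ) k => x (Fin.castAdd e (Fin.natAdd a k))) fun k => .coord _
  refine ⟨⟨0, m, .affine 0 0, .affine 0 0, φ, .affine 0 0, Γ⟩, rfl, ?_, ?_, fun ν G E X v => ?_⟩
  · simp only [width, hφ1, MLP.hiddenWidth]
    omega
  · simp only [mlpDepth, hφ2, MLP.depth]
    omega
  · have h : ∀ i, (φ.eval ν (Fin.append (Fin.append (X i) v) (E.fromVN i))) = v := fun i => by
      simp [hφ]
    simp [evalGN, h, MLP.eval, Pooling.apply_zero]

end HeteroLayer

/-- A mean layer followed by a broadcast layer, prepended to a network. -/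
theorem MPNNVN.exists_cons_cons {a m b b' q' : ℕ} (pool : Pooling) (e n p : ℕ) (Φ : MLP a m)
    (Γ : MLP (a + m) b) (N : MPNNVN e b 0 b' q') (hN : N.IsSimplified) :
    ∃ N' : MPNNVN e a p b' q', N'.IsSimplified ∧ N'.depth = N.depth + 2 ∧
      N'.width ≤ max (max (max a p) (max m b))
        (max (max Φ.hiddenWidth Γ.hiddenWidth) N.width) ∧
      N'.mlpDepth ≤ max (max 1 Φ.depth) (max Γ.depth N.mlpDepth) ∧
      ∀ (ν : ℝ → ℝ) (G : SimpleGraph (Fin n)) (E : EdgeFeatures e n) (X : Matrix (Fin n) (Fin a) ℝ)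
        (v : Fin p → ℝ), N'.evalFrom pool ν G E X v = N.evalFrom pool ν G E
          (Matrix.of fun i => Γ.eval ν (Fin.append (X i) ((n : ℝ)⁻¹ • ∑ j, Φ.eval ν (X j)))) 0 := by
  obtain ⟨L, hL, hLw, hLd, hLe⟩ := HeteroLayer.exists_mean pool e n p Φ
  obtain ⟨M, hM, hMw, hMd, hMe⟩ := HeteroLayer.exists_broadcast pool e n Γ
  refine ⟨.cons L (.cons M N), ⟨hL, hM, hN⟩, rfl, ?_, ?_, fun ν G E X v => ?_⟩
  · refine max_le (hLw.trans (max_le (max_le ?_ ?_) (max_le ?_ ?_)))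
      (max_le (hMw.trans (max_le (max_le ?_ ?_) (max_le ?_ ?_))) ?_) <;>
      simp only [le_max_iff, le_refl, true_or, or_true]
  · refine max_le (hLd.trans (max_le ?_ ?_)) (max_le (hMd.trans (max_le ?_ ?_)) ?_) <;>
      simp only [le_max_iff, le_refl, true_or, or_true]
  -- The broadcast layer leaves a virtual node of dimension `0`, so `N` starts from the feature `0`.
  · have h0 : M.evalVN pool ν E (L.evalGN pool ν G E X v) (L.evalVN pool ν E X v) = 0 :=
      Subsingleton.elim _ _
    simp only [evalFrom]
    rw [h0, hMe, (hLe ν G E X v).1, (hLe ν G E X v).2]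

/-! ### Exact simulation of DeepSets -/

theorem deepSetsLinear_apply {n a b : ℕ} (A B : Matrix (Fin a) (Fin b) ℝ) (c : Fin b → ℝ)
    (X : Matrix (Fin n) (Fin a) ℝ) (i : Fin n) (k : Fin b) :
    deepSetsLinear A B c X i k = ∑ l, A l k * X i l +
      ∑ l, B l k * ((n : ℝ)⁻¹ • ∑ j, X j) l + c k := by
  have h : ∀ l, (∑ j, X j) l = ∑ j, X j l := fun l => Finset.sum_apply l _ _
  simp only [deepSetsLinear, Matrix.add_apply, Matrix.smul_apply, Matrix.mul_apply,
    Matrix.vecMulVec_apply, Pi.one_apply, one_mul, smul_eq_mul, Pi.smul_apply, h, one_div,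
    mul_comm (X i _)]
  rw [Finset.mul_sum]
  congr 2
  exact Finset.sum_congr rfl fun l _ => by ring

theorem isAffineFun_deepSetsLinear {a b : ℕ} (A B : Matrix (Fin a) (Fin b) ℝ) (c : Fin b → ℝ)
    (k : Fin b) : IsAffineFun fun x : Fin (a + a) → ℝ =>
      ∑ l, A l k * x (Fin.castAdd a l) + ∑ l, B l k * x (Fin.natAdd a l) + c k :=
  ((IsAffineFun.sum _ fun _ => (IsAffineFun.coord _).const_mul _).add
    (IsAffineFun.sum _ fun _ => (IsAffineFun.coord _).const_mul _)).add (.const _)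

theorem DeepSets.le_width {a b : ℕ} (F : DeepSets a b) : a ≤ F.width := by
  cases F <;> exact le_max_left _ _

/-- The dimension `p` is general because the virtual node has dimension `d` at the start of the
whole network but `0` after each simulated linear map. -/
theorem DeepSets.exists_mpnnvn (pool : Pooling) (e n : ℕ) {a b : ℕ} (F : DeepSets a b) :
    ∀ p : ℕ, p ≤ F.width → ∃ (p' : ℕ) (N : MPNNVN e a p b p'), N.IsSimplified ∧
      N.depth = 2 * F.depth ∧ N.width ≤ F.width ∧ N.mlpDepth ≤ 2 ∧
      ∀ (ν : ℝ → ℝ) (G : SimpleGraph (Fin n)) (E : EdgeFeatures e n) (X : Matrix (Fin n) (Fin a) ℝ)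
        (v : Fin p → ℝ), N.evalFrom pool ν G E X v = F.eval ν X := by
  induction F with
  | @last a b A B c =>
    intro p hp
    obtain ⟨Φ, hΦ1, hΦ2, hΦ⟩ := MLP.exists_affine (fun x : Fin a → ℝ => x) fun k => .coord _
    obtain ⟨Γ, hΓ1, hΓ2, hΓ⟩ := MLP.exists_affine _ (isAffineFun_deepSetsLinear A B c)
    obtain ⟨N, h1, h2, h3, h4, h5⟩ := MPNNVN.exists_cons_cons pool e n p Φ Γ .nil trivial
    simp only [width, MPNNVN.width, MPNNVN.depth, MPNNVN.mlpDepth] at *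
    refine ⟨0, N, h1, h2, by omega, by omega, fun ν G E X v => ?_⟩
    rw [h5]
    ext i k
    simp only [MPNNVN.evalFrom, Matrix.of_apply, hΓ, hΦ, Fin.append_left, Fin.append_right, eval,
      deepSetsLinear_apply]
  | @layer a h b A B c rest ih =>
    intro p hp
    obtain ⟨q, M, hM1, hM2, hM3, hM4, hM5⟩ := ih 0 (Nat.zero_le _)
    obtain ⟨Φ, hΦ1, hΦ2, hΦ⟩ := MLP.exists_affine (fun x : Fin a → ℝ => x) fun k => .coord _
    obtain ⟨Γ, hΓ1, hΓ2, hΓ⟩ := MLP.exists_affine_map _ (isAffineFun_deepSetsLinear A B c)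
    obtain ⟨N, h1, h2, h3, h4, h5⟩ := MPNNVN.exists_cons_cons pool e n p Φ Γ M hM1
    have := rest.le_width
    simp only [width, depth] at *
    refine ⟨q, N, h1, by omega, by omega, by omega, fun ν G E X v => ?_⟩
    rw [h5, hM5, eval]
    congr 1
    ext i k
    simp only [Matrix.of_apply, hΓ, hΦ, Fin.append_left, Fin.append_right, Matrix.map_apply,
      deepSetsLinear_apply]

/-! ### Universality -/

/-- `Γ` is fixed first, and its uniform continuity near `T` then sets the accuracy demanded of `Φ`.
Points of `T` are compared with points possibly outside `T`, so uniform continuity on `T` alone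
would not suffice. -/
theorem exists_forall_within_of_approx {n d d' : ℕ} {𝒳 : Set (Matrix (Fin n) (Fin d) ℝ)}
    {H : Matrix (Fin n) (Fin d) ℝ → Matrix (Fin n) (Fin d') ℝ}
    {T : Set (Fin (d + (2 * n + 1) ^ d) → ℝ)} {ρ : (Fin (d + (2 * n + 1) ^ d) → ℝ) → Fin d' → ℝ}
    (hT : IsCompact T)
    (hρ : ∀ X ∈ 𝒳, ∀ i, pooledFeatures X i ∈ T ∧ ρ (pooledFeatures X i) = H X i)
    {ε : ℝ} (hε : 0 < ε) (Γ : MLP (d + (2 * n + 1) ^ d) d')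
    (hΓ : ∀ z ∈ T, ∀ k, |ρ z k - Γ.eval relu z k| < ε / 2) :
    ∃ δ : ℝ, 0 < δ ∧ ∀ Φ : MLP d ((2 * n + 1) ^ d),
      (∀ X ∈ 𝒳, ∀ j l, |monomialFeatures n d (X j) l - Φ.eval relu (X j) l| < δ) →
      ∀ X ∈ 𝒳, ∀ i k, |H X i k -
        Γ.eval relu (Fin.append (X i) ((n : ℝ)⁻¹ • ∑ j, Φ.eval relu (X j))) k| < ε := by
  have huc := hT.uniformContinuousAt_of_continuousAt (Γ.eval relu)
    (fun z _ => (Γ.continuous_eval continuous_relu).continuousAt)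
    (Metric.dist_mem_uniformity (half_pos hε))
  obtain ⟨δ, hδ, hu⟩ := Metric.mem_uniformity_dist.1 huc
  refine ⟨δ / 2, half_pos hδ, fun Φ hΦ X hX i k => ?_⟩
  obtain ⟨hzT, hz⟩ := hρ X hX i
  have hn : (0 : ℝ) < n := Nat.cast_pos.2 (Fin.pos i)
  have hd : dist (pooledFeatures X i)
      (Fin.append (X i) ((n : ℝ)⁻¹ • ∑ j, Φ.eval relu (X j))) < δ := by
    rw [dist_pi_lt_iff hδ]
    intro l
    refine Fin.addCases (fun l => ?_) (fun l => ?_) l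
    · simpa [pooledFeatures] using hδ
    · simp only [pooledFeatures, Fin.append_right, Pi.smul_apply, Finset.sum_apply, smul_eq_mul,
        Real.dist_eq, ← mul_sub, ← Finset.sum_sub_distrib]
      rw [abs_mul, abs_of_pos (inv_pos.2 hn)]
      refine lt_of_le_of_lt ?_ (half_lt_self hδ)
      rw [inv_mul_le_iff₀ hn]
      refine (Finset.abs_sum_le_sum_abs _ _).trans
        ((Finset.sum_le_sum fun j _ => (hΦ X hX j l).le).trans (by simp))
  have h1 := hΓ _ hzT k
  have h2 := (dist_pi_lt_iff (half_pos hε)).1 (hu hd hzT) k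
  rw [hz] at h1
  rw [Real.dist_eq] at h2
  calc _ ≤ _ := abs_sub_le _ (Γ.eval relu (pooledFeatures X i) k) _
    _ < ε / 2 + ε / 2 := add_lt_add h1 h2
    _ = ε := add_halves ε

theorem approximableByMPNNVN_of_continuousOn (pool : Pooling) (e : ℕ) {n d d' : ℕ} (hn : 0 < n)
    {𝒳 : Set (Matrix (Fin n) (Fin d) ℝ)} (h𝒳 : IsCompact 𝒳)
    {H : Matrix (Fin n) (Fin d) ℝ → Matrix (Fin n) (Fin d') ℝ} (hc : ContinuousOn H 𝒳)
    (hH : PermEquivariantOn 𝒳 H) :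
    ApproximableByMPNNVN pool e 2 ((2 * 3 ^ d + 2 * d + 2 * d' + 1) * n ^ d) 𝒳 H := by
  intro ε hε
  obtain ⟨T, ρ, hT, hρc, hρ⟩ := hH.exists_eq_comp_pooledFeatures h𝒳 hc
  obtain ⟨⟨Γ₁, hw₁, hΓ₁⟩, Γ₂, hd₂, hΓ₂⟩ := MLP.exists_approx hT ρ hρc (half_pos hε)
  obtain ⟨δ₁, hδ₁, h₁⟩ := exists_forall_within_of_approx hT hρ hε Γ₁ hΓ₁
  obtain ⟨δ₂, hδ₂, h₂⟩ := exists_forall_within_of_approx hT hρ hε Γ₂ hΓ₂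
  have hR : IsCompact (⋃ j : Fin n, (fun X : Matrix (Fin n) (Fin d) ℝ => X j) '' 𝒳) :=
    isCompact_iUnion fun j => h𝒳.image (continuous_apply j)
  have hmem : ∀ X ∈ 𝒳, ∀ j, X j ∈ ⋃ j : Fin n, (fun X : Matrix (Fin n) (Fin d) ℝ => X j) '' 𝒳 :=
    fun X hX j => Set.mem_iUnion.2 ⟨j, X, hX, rfl⟩
  have hmono := (continuous_monomialFeatures n d).continuousOn (s :=
    ⋃ j : Fin n, (fun X : Matrix (Fin n) (Fin d) ℝ => X j) '' 𝒳)
  obtain ⟨Φ₁, hv₁, hΦ₁⟩ := (MLP.exists_approx hR _ hmono hδ₁).1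
  obtain ⟨Φ₂, hv₂, hΦ₂⟩ := (MLP.exists_approx hR _ hmono hδ₂).2
  obtain ⟨N₁, hs₁, hN₁, hNw, -, he₁⟩ := MPNNVN.exists_cons_cons pool e n d Φ₁ Γ₁ .nil trivial
  obtain ⟨N₂, hs₂, hN₂, -, hNd, he₂⟩ := MPNNVN.exists_cons_cons pool e n d Φ₂ Γ₂ .nil trivial
  refine ⟨⟨0, N₁, hs₁, hN₁.le, ?_, fun G E X hX i k => ?_⟩,
    ⟨0, N₂, hs₂, hN₂.le, ?_, fun G E X hX i k => ?_⟩⟩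
  · have hM : (2 * n + 1) ^ d ≤ 3 ^ d * n ^ d := by
      rw [← Nat.mul_pow]
      exact Nat.pow_le_pow_left (by omega) d
    have hnd : 1 ≤ n ^ d := Nat.one_le_pow _ _ hn
    -- The left side is the narrow-network bound `2a + 2b + 1` for `Γ₁`, with `a = d + (2n+1)^d` and
    -- `b = d'`; it also dominates the bound for `Φ₁`.
    have hle : 2 * (2 * n + 1) ^ d + 2 * d + 2 * d' + 1 ≤
        (2 * 3 ^ d + 2 * d + 2 * d' + 1) * n ^ d := by nlinarith
    simp only [MPNNVN.width] at hNw
    omega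
  · rw [MPNNVN.eval, he₁]
    exact h₁ Φ₁ (fun X hX j => hΦ₁ _ (hmem X hX j)) X hX i k
  · simp only [MPNNVN.mlpDepth] at hNd
    omega
  · rw [MPNNVN.eval, he₂]
    exact h₂ Φ₂ (fun X hX j => hΦ₂ _ (hmem X hX j)) X hX i k

/-! ### Self-attention and transformers -/

theorem continuous_selfAttention {n d k d' : ℕ} (WQ WK : Matrix (Fin d) (Fin k) ℝ)
    (WV : Matrix (Fin d) (Fin d') ℝ) :
    Continuous (selfAttention (n := n) WQ WK WV) := by
  refine Continuous.matrix_mul ?_ (continuous_id.matrix_mul continuous_const)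
  have hM : Continuous fun X : Matrix (Fin n) (Fin d) ℝ => (X * WQ) * (X * WK).transpose :=
    (continuous_id.matrix_mul continuous_const).matrix_mul
      (continuous_id.matrix_mul continuous_const).matrix_transpose
  refine continuous_matrix fun i j => ?_
  have : Nonempty (Fin n) := ⟨i⟩
  refine (Real.continuous_exp.comp (hM.matrix_elem i j)).div
    (continuous_finsetSum _ fun l _ => Real.continuous_exp.comp (hM.matrix_elem i l)) fun X => ?_
  exact (Finset.sum_pos (fun l _ => Real.exp_pos _) Finset.univ_nonempty).ne'

theorem selfAttention_submatrix {n d k d' : ℕ} (WQ WK : Matrix (Fin d) (Fin k) ℝ)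
    (WV : Matrix (Fin d) (Fin d') ℝ) (σ : Equiv.Perm (Fin n)) (X : Matrix (Fin n) (Fin d) ℝ) :
    selfAttention WQ WK WV (X.submatrix σ id) = (selfAttention WQ WK WV X).submatrix σ id := by
  ext i j
  simp only [selfAttention, softmaxRows, Matrix.mul_apply, Matrix.submatrix_apply, Matrix.of_apply,
    Matrix.transpose_apply, id]
  -- The permutation of the keys disappears on reindexing by `σ` both the softmax denominator and
  -- the sum over values.
  rw [← Equiv.sum_comp σ fun l => Real.exp (∑ q, (∑ r, X (σ i) r * WQ r q) *
    ∑ r, X l r * WK r q)]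
  exact Equiv.sum_comp σ fun l => Real.exp (∑ q, (∑ r, X (σ i) r * WQ r q) *
    ∑ r, X l r * WK r q) / (∑ l, Real.exp (∑ q, (∑ r, X (σ i) r * WQ r q) *
    ∑ r, X (σ l) r * WK r q)) * ∑ r, X l r * WV r j

theorem continuous_layerNorm {d : ℕ} {δ : ℝ} (hδ : 0 < δ) (g b : Fin d → ℝ) :
    Continuous (layerNorm δ g b) := by
  refine continuous_pi fun k => ?_
  simp only [layerNorm]
  refine (continuous_const.mul (Continuous.div (by fun_prop) (by fun_prop) fun x => ?_)).add
    continuous_const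
  exact (Real.sqrt_pos.2 (by positivity)).ne'

namespace Transformer

variable {n d : ℕ}

theorem continuous_eval (T : Transformer d) :
    Continuous (T.eval : Matrix (Fin n) (Fin d) ℝ → Matrix (Fin n) (Fin d) ℝ) := by
  induction T with
  | id => exact continuous_id
  | comp S T hS hT => exact hS.comp hT
  | attention WQ WK WV => exact continuous_finsetSum _ fun h _ => continuous_selfAttention _ _ _
  | feedForward ν hν f =>
    exact continuous_pi fun i => (f.continuous_eval hν).comp (continuous_apply i)
  | norm δ hδ g b =>
    exact continuous_pi fun i => (continuous_layerNorm hδ g b).comp (continuous_apply i)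
  | residual T hT => exact continuous_id.add hT

theorem eval_submatrix (T : Transformer d) (σ : Equiv.Perm (Fin n))
    (X : Matrix (Fin n) (Fin d) ℝ) :
    T.eval (X.submatrix σ _root_.id) = (T.eval X).submatrix σ _root_.id := by
  induction T generalizing X with
  | id => rfl
  | comp S T hS hT => simp only [eval, hT, hS]
  | attention WQ WK WV =>
    simp only [eval, selfAttention_submatrix]
    ext i j
    simp [Matrix.sum_apply]
  | feedForward ν hν f => rfl
  | norm δ hδ g b => rfl
  | residual T hT => simp only [eval, hT, Matrix.submatrix_add, Pi.add_apply]

end Transformer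

theorem theorem2 :
    ∃ (C : ℕ) (K : ℕ → ℕ → ℕ), ∀ (pool : Pooling) (e n d d' : ℕ), 0 < n →
      (∀ (ν : ℝ → ℝ) (F : DeepSets d d'), ∃ (p' : ℕ) (N : MPNNVN e d d d' p'),
        N.IsSimplified ∧ N.depth ≤ C * F.depth ∧ N.width ≤ C * F.width ∧ N.mlpDepth ≤ C ∧
        ∀ (G : SimpleGraph (Fin n)) (E : EdgeFeatures e n) (X : Matrix (Fin n) (Fin d) ℝ),
          N.eval pool ν G E X = F.eval ν X) ∧
      (∀ 𝒳 : Set (Matrix (Fin n) (Fin d) ℝ), IsCompact 𝒳 →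
        (∀ H : Matrix (Fin n) (Fin d) ℝ → Matrix (Fin n) (Fin d') ℝ,
          ContinuousOn H 𝒳 → PermEquivariantOn 𝒳 H →
            ApproximableByMPNNVN pool e C (K d d' * n ^ d) 𝒳 H) ∧
        (∀ (k : ℕ) (WQ WK : Matrix (Fin d) (Fin k) ℝ) (WV : Matrix (Fin d) (Fin d') ℝ),
          ApproximableByMPNNVN pool e C (K d d' * n ^ d) 𝒳 (selfAttention WQ WK WV)) ∧
        (∀ T : Transformer d,
          ApproximableByMPNNVN pool e C (K d d * n ^ d) 𝒳 T.eval)) := by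
  -- The `2` counts the mean and broadcast layers and also bounds the depth of the MLPs.
  refine ⟨2, fun d d' => 2 * 3 ^ d + 2 * d + 2 * d' + 1, fun pool e n d d' hn =>
    ⟨fun ν F => ?_, fun 𝒳 h𝒳 => ⟨fun H hc hH => ?_, fun k WQ WK WV => ?_, fun T => ?_⟩⟩⟩
  · obtain ⟨p', N, h1, h2, h3, h4, h5⟩ := F.exists_mpnnvn pool e n d F.le_width
    exact ⟨p', N, h1, h2.le, by omega, h4, fun G E X => h5 ν G E X 0⟩
  · exact approximableByMPNNVN_of_continuousOn pool e hn h𝒳 hc hH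
  · exact approximableByMPNNVN_of_continuousOn pool e hn h𝒳
      (continuous_selfAttention WQ WK WV).continuousOn
      fun σ X _ _ => selfAttention_submatrix WQ WK WV σ X
  · exact approximableByMPNNVN_of_continuousOn pool e hn h𝒳 T.continuous_eval.continuousOn
      fun σ X _ _ => T.eval_submatrix σ X
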